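/- Let $V:\mathbb R\to\mathbb R$ be continuous and suppose that $0<v_0\le V(x)\le v_1$ for a.e. $x\in\mathbb R$, for some constants $v_0,v_1$. Functions in the real Sobolev space $H^1(\mathbb R)$ are identified with their continuous representatives. For $u\in H^1(\mathbb R)$ set $$\|u\|_V^2=\int_{\mathbb R}\bigl(|u'(x)|^2+V(x)|u(x)|^2\bigr)\,dx ,\qquad R(u;V)=\frac{\|u\|_V^2}{\|u\|_\infty^2}\quad(u\not\equiv 0),$$ where $\|\cdot\|_\infty$ is the norm of $L^\infty(\mathbb R)$, and let $$m(V)=\inf_{u\in H^1(\mathbb R),\,u\not\equiv0}R(u;V),\qquad M(V)=\{u\in H^1(\mathbb R):\ u\not\equiv 0,\ R(u;V)=m(V)\}.$$ For $a\in\mathbb R$ put $K_a=\{u\in H^1(\mathbb R):\ u(a)=\|u\|_\infty=1\}$ and $F(a)=\inf_{u\in K_a}\|u\|_V^2$. Then for every $a\in\mathbb R$ this infimum is attained at exactly one element $u_a$ of $K_a$, and $F\in C^2(\mathbb R)$. Put $$N(V)=\{a\in\mathbb R:\ F'(a)=0,\ F''(a)\ge 0\}.$$ Then, with the convention $\inf\emptyset=+\infty$,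 $$m(V)=\min\Bigl(\liminf_{|a|\to\infty}F(a),\ \inf_{a\in N(V)}F(a)\Bigr),$$ $$M(V)=\{c\,u_a:\ c\in\mathbb R\setminus\{0\},\ a\in\mathbb R,\ F(a)=m(V)\}.$$ In particular, $M(V)=\emptyset$ if and only if $\liminf_{|a|\to\infty}F(a)<F(b)$ for all $b\in N(V)$. -/

import Mathlib

open MeasureTheory Filter Topology
open scoped ContDiff

noncomputable section

namespace SobolevBest

/-- `g` is a weak (distributional) derivative of `u` on `ℝ`: integration by parts holds against
every smooth compactly supported test function. -/
def IsWeakDeriv (u g : ℝ → ℝ) : Prop :=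
  ∀ φ : ℝ → ℝ, ContDiff ℝ ∞ φ → HasCompactSupport φ →
    ∫ x, u x * deriv φ x = -∫ x, g x * φ x

/-- `u ∈ H¹(ℝ)`, where each class is represented by its continuous representative: `u` is
continuous, square integrable, and has a square integrable weak derivative. -/
def MemH1 (u : ℝ → ℝ) : Prop :=
  Continuous u ∧ MemLp u 2 ∧ ∃ g : ℝ → ℝ, MemLp g 2 ∧ IsWeakDeriv u g

open Classical in
/-- The weak derivative `u'` of `u ∈ H¹(ℝ)`, a function determined up to a null set. -/
def weakDeriv (u : ℝ → ℝ) : ℝ → ℝ :=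
  if h : ∃ g : ℝ → ℝ, MemLp g 2 ∧ IsWeakDeriv u g then h.choose else 0

/-- `‖u‖_V² = I(u; V) = ∫ (|u'|² + V |u|²) dx`. -/
def energy (V u : ℝ → ℝ) : ℝ :=
  ∫ x, (|weakDeriv u x| ^ 2 + V x * |u x| ^ 2)

/-- The norm of `L^∞(ℝ)`. -/
def supNorm (u : ℝ → ℝ) : ℝ := (eLpNorm u ⊤ volume).toReal

/-- The Rayleigh-type quotient `R(u; V) = ‖u‖_V² / ‖u‖_∞²`. -/
def rayleigh (V u : ℝ → ℝ) : ℝ := energy V u / supNorm u ^ 2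

/-- `m(V)`, the infimum of `R(u; V)` over nonzero `u ∈ H¹(ℝ)`. -/
def m (V : ℝ → ℝ) : ℝ := sInf (rayleigh V '' {u | MemH1 u ∧ u ≠ 0})

/-- `M(V)`, the set of minimizers of `R(·; V)` over nonzero `u ∈ H¹(ℝ)`. -/
def M (V : ℝ → ℝ) : Set (ℝ → ℝ) := {u | MemH1 u ∧ m V = rayleigh V u ∧ u ≠ 0}

/-- `K_a = {u ∈ H¹(ℝ) : u(a) = ‖u‖_∞ = 1}`. -/
def K (a : ℝ) : Set (ℝ → ℝ) := {u | MemH1 u ∧ u a = 1 ∧ supNorm u = 1}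

/-- `F(a)`, the infimum of `I(u; V)` over `u ∈ K_a`. -/
def F (V : ℝ → ℝ) (a : ℝ) : ℝ := sInf (energy V '' K a)

open Classical in
/-- `u_a`, the minimizer of `‖u‖_V²` over `K_a` (the value `0` is used only if there is none). -/
def minimizer (V : ℝ → ℝ) (a : ℝ) : ℝ → ℝ :=
  if h : ∃ u ∈ K a, IsMinOn (energy V) (K a) u then h.choose else 0

/-- `N(V) = {a : F'(a) = 0, F''(a) ≥ 0}`. -/
def N (V : ℝ → ℝ) : Set ℝ := {a | deriv (F V) a = 0 ∧ 0 ≤ deriv (deriv (F V)) a}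

/-- `liminf_{|a| → ∞} F(a)`, in the extended reals. -/
def liminfF (V : ℝ → ℝ) : EReal :=
  liminf (fun a : ℝ => (F V a : EReal)) (comap (fun a : ℝ => |a|) atTop)

end SobolevBest

end

open scoped BoundedContinuousFunction

/-! ### Weak derivatives and local absolute continuity. -/

namespace SobolevBest

/-! Choose c, d > 0 with c² ≤ V ≤ d². The Riccati equations p' = p² - V and q' = V - q² have
solutions on the whole line with values in [c, d]: `exists_riccati` finds p as the fixed point of a
contraction, and q comes by reflection. Since u'² + V u² + (p u²)' = (u' + p u)², and likewise with
-q in place of p, integrating over the two sides of a gives ‖u‖_V² = ∫_{x>a} (u' + p u)² + ∫_{x≤a}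
(u' - q u)² + (p(a) + q(a)) u(a)² (`IsRiccatiPair.energy_eq`). The squares vanish exactly when u' =
-p u after a and u' = q u before a. The solution with value 1 at a is `profile p q a`; it peaks at
a, so it lies in `K a`. Hence F = p + q with a unique minimizer, and F is C² because V cancels in F'
= p² - q².

For nonzero u in H¹, |u| attains its maximum at some a, so R(u) ≥ F(a), with equality only for
multiples of the profile at a. Thus m(V) = inf F, and M(V) is read off. Finally, F either attains
its infimum, necessarily at a point of N(V), or has that infimum as its liminf at infinity.

To make this calculus legitimate, `memH1_iff` replaces weak derivatives by a.e. derivatives of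
locally absolutely continuous functions. -/

theorem const_of_forall_integral_mul_deriv_eq_zero {h : ℝ → ℝ} (hc : Continuous h)
    (h0 : ∀ φ : ℝ → ℝ, ContDiff ℝ ∞ φ → HasCompactSupport φ → ∫ x, h x * deriv φ x = 0)
    (x y : ℝ) : h x = h y := by
  -- Mollify h with shrinking bumps. Each convolution has zero derivative, because the hypothesis
  -- applies to the translated and reflected bump; constancy then passes to the limit.
  let φ : ℕ → ContDiffBump (0 : ℝ) := fun n =>
    { rIn := 1 / (n + 1 : ℝ) / 2
      rOut := 1 / (n + 1 : ℝ)
      rIn_pos := by positivity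
      rIn_lt_rOut := half_lt_self (by positivity) }
  have hφ : Tendsto (fun n => (φ n).rOut) atTop (𝓝 0) :=
    tendsto_one_div_add_atTop_nhds_zero_nat
  have key (n : ℕ) : (convolution ((φ n).normed volume) h (ContinuousLinearMap.lsmul ℝ ℝ)) x
      = (convolution ((φ n).normed volume) h (ContinuousLinearMap.lsmul ℝ ℝ)) y := by
    set ρ := (φ n).normed (volume : Measure ℝ) with hρ
    have hρs : ContDiff ℝ ∞ ρ := (φ n).contDiff_normed
    have hρc : HasCompactSupport ρ := (φ n).hasCompactSupport_normed
    have hd (t : ℝ) : HasDerivAt (convolution ρ h (ContinuousLinearMap.lsmul ℝ ℝ)) 0 t := by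
      have := HasCompactSupport.hasDerivAt_convolution_left (ContinuousLinearMap.lsmul ℝ ℝ)
        (μ := volume) hρc (hρs.of_le (by simp)) (hc.locallyIntegrable) t
      suffices e : convolution (deriv ρ) h (ContinuousLinearMap.lsmul ℝ ℝ) volume t = 0 by
        rwa [e] at this
      rw [convolution_eq_swap]
      have h1 := h0 (fun s => ρ (t - s)) (hρs.comp (contDiff_const.sub contDiff_id))
        (hρc.comp_homeomorph (Homeomorph.subLeft t))
      have h2 (s : ℝ) : deriv (fun s => ρ (t - s)) s = - deriv ρ (t - s) := by
        rw [deriv_comp_const_sub]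
      simp only [h2, mul_neg, integral_neg, neg_eq_zero] at h1
      simp only [ContinuousLinearMap.lsmul_apply, smul_eq_mul]
      rw [← h1]
      exact integral_congr_ae (Eventually.of_forall fun s => by simp [mul_comm])
    exact is_const_of_deriv_eq_zero (fun t => (hd t).differentiableAt)
      (fun t => (hd t).deriv) x y
  have hx := ContDiffBump.convolution_tendsto_right_of_continuous (μ := volume) hφ hc x
  have hy := ContDiffBump.convolution_tendsto_right_of_continuous (μ := volume) hφ hc y
  refine tendsto_nhds_unique hx (hy.congr fun n => (key n).symm)

/-- Absolute continuity on every compact interval. -/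
def LocallyAC (u : ℝ → ℝ) : Prop := ∀ a b : ℝ, AbsolutelyContinuousOnInterval u a b

namespace LocallyAC

variable {u v : ℝ → ℝ}

theorem continuous (hu : LocallyAC u) : Continuous u := by
  rw [continuous_iff_continuousAt]
  intro x
  have := (hu (x - 1) (x + 1)).continuousOn
  rw [Set.uIcc_of_le (by linarith)] at this
  exact this.continuousAt (Icc_mem_nhds (by linarith) (by linarith))

theorem mul (hu : LocallyAC u) (hv : LocallyAC v) : LocallyAC (fun x => u x * v x) :=
  fun a b => (hu a b).fun_mul (hv a b)

theorem ae_differentiableAt (hu : LocallyAC u) : ∀ᵐ x, DifferentiableAt ℝ u x := by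
  have : ∀ᵐ x, ∀ n : ℕ, x ∈ Set.uIcc (-n : ℝ) n → DifferentiableAt ℝ u x :=
    ae_all_iff.2 fun n => (hu _ _).ae_differentiableAt
  filter_upwards [this] with x hx
  obtain ⟨n, hn⟩ := exists_nat_ge |x|
  refine hx n ?_
  rw [Set.uIcc_of_le (by linarith [abs_nonneg x])]
  exact abs_le.1 hn

theorem of_contDiff (hu : ContDiff ℝ 1 u) : LocallyAC u :=
  fun _ _ => hu.contDiffOn.absolutelyContinuousOnInterval

theorem isWeakDeriv (hu : LocallyAC u) : IsWeakDeriv u (deriv u) := by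
  intro φ hφ hφc
  obtain ⟨R, hR⟩ := hφc.isCompact.isBounded.subset_ball_lt 0 0
  have hs : Function.support φ ⊆ Set.Ioc (-R) R := by
    refine (subset_tsupport φ).trans (hR.2.trans ?_)
    rw [Real.ball_eq_Ioo]; simpa using Set.Ioo_subset_Ioc_self
  have hs' : Function.support (deriv φ) ⊆ Set.Ioc (-R) R := by
    refine (support_deriv_subset (f := φ)).trans (hR.2.trans ?_)
    rw [Real.ball_eq_Ioo]; simpa using Set.Ioo_subset_Ioc_self
  have h0 (x : ℝ) (hx : |x| = R) : φ x = 0 := by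
    by_contra hne
    have := hR.2 (subset_tsupport φ hne)
    rw [Metric.mem_ball, Real.dist_eq, sub_zero, hx] at this
    exact lt_irrefl _ this
  have hRp := hR.1
  rw [← intervalIntegral.integral_eq_integral_of_support_subset (a := -R) (b := R)
      ((Function.support_mul_subset_right u (deriv φ)).trans hs'),
    ← intervalIntegral.integral_eq_integral_of_support_subset (a := -R) (b := R)
      ((Function.support_mul_subset_right (deriv u) φ).trans hs),
    (hu (-R) R).integral_mul_deriv_eq_deriv_mul (of_contDiff (hφ.of_le (by simp)) (-R) R),
    h0 R (abs_of_pos hRp), h0 (-R) (by rw [abs_neg, abs_of_pos hRp])]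
  ring

end LocallyAC

theorem locallyAC_integral {g : ℝ → ℝ} (hg : LocallyIntegrable g) (c : ℝ) :
    LocallyAC (fun x => ∫ t in c..x, g t) := by
  have hg' (x y : ℝ) : IntervalIntegrable g volume x y := 
    (hg.integrableOn_isCompact isCompact_uIcc).intervalIntegrable
  intro a b
  have h2 := ((hg' (min a b ⊓ c) (max a b ⊔ c)).absolutelyContinuousOnInterval_intervalIntegral
    (c := c) (by simp))
  refine h2.mono ?_
  rw [Set.uIcc_of_le (a := _ ⊓ _) (by simp), Set.uIcc]
  exact Set.Icc_subset_Icc inf_le_left le_sup_left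

/-- A primitive G of g is locally absolutely continuous and also has weak derivative g, so u - G has
zero weak derivative and is constant. -/
theorem IsWeakDeriv.locallyAC {u g : ℝ → ℝ} (hu : Continuous u) (hg : LocallyIntegrable g)
    (h : IsWeakDeriv u g) : LocallyAC u ∧ deriv u =ᵐ[volume] g := by
  set G : ℝ → ℝ := fun x => ∫ t in (0 : ℝ)..x, g t with hG
  have hGac := locallyAC_integral hg 0
  have hGd : deriv G =ᵐ[volume] g := by
    filter_upwards [_root_.LocallyIntegrable.ae_hasDerivAt_integral hg] with x hx using (hx 0).deriv
  have hconst := const_of_forall_integral_mul_deriv_eq_zero (h := fun x => u x - G x)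
    (hu.sub hGac.continuous) (fun φ hφ hφc => by
      have h1 := h φ hφ hφc
      have h2 := hGac.isWeakDeriv φ hφ hφc
      have h3 : ∫ x, deriv G x * φ x = ∫ x, g x * φ x :=
        integral_congr_ae (by filter_upwards [hGd] with x hx; rw [hx])
      have hi (f : ℝ → ℝ) (hf : Continuous f) : Integrable (fun x => f x * deriv φ x) :=
        (hf.mul (hφ.continuous_deriv (by simp))).integrable_of_hasCompactSupport
          (hφc.deriv.mul_left)
      simp only [sub_mul]
      rw [integral_sub (hi _ hu) (hi _ hGac.continuous), h1, h2, h3, sub_self])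
  have hu' : u = fun x => G x + u 0 := by
    ext x
    have := hconst x 0
    simp only [hG, intervalIntegral.integral_same] at this ⊢
    linarith
  refine ⟨?_, ?_⟩
  · rw [hu']
    exact fun a b => (hGac a b).fun_add (LocallyAC.of_contDiff contDiff_const a b)
  · rw [hu']
    filter_upwards [hGd] with x hx
    rw [deriv_add_const, hx]

theorem memH1_iff {u : ℝ → ℝ} :
    MemH1 u ↔ LocallyAC u ∧ MemLp u 2 ∧ MemLp (deriv u) 2 := by
  constructor
  · rintro ⟨hc, hu, g, hg, hw⟩
    obtain ⟨h1, h2⟩ := hw.locallyAC hc (hg.locallyIntegrable one_le_two)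
    exact ⟨h1, hu, (memLp_congr_ae h2).2 hg⟩
  · rintro ⟨h1, h2, h3⟩
    exact ⟨h1.continuous, h2, _, h3, h1.isWeakDeriv⟩

theorem MemH1.weakDeriv_ae_eq {u : ℝ → ℝ} (hu : MemH1 u) : weakDeriv u =ᵐ[volume] deriv u := by
  have h := hu.2.2
  rw [weakDeriv, dif_pos h]
  exact (h.choose_spec.2.locallyAC hu.1 (h.choose_spec.1.locallyIntegrable one_le_two)).2.symm

theorem MemH1.energy_eq {u : ℝ → ℝ} (hu : MemH1 u) (V : ℝ → ℝ) :
    energy V u = ∫ x, (deriv u x ^ 2 + V x * u x ^ 2) := by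
  refine integral_congr_ae ?_
  filter_upwards [hu.weakDeriv_ae_eq] with x hx
  rw [hx, sq_abs, sq_abs]

/-! ### Global bounded solutions of the Riccati equation. -/

/-- The bounded solution of `y' = r y - h`. -/
noncomputable def expAvg (r : ℝ) (h : ℝ → ℝ) (x : ℝ) : ℝ :=
  Real.exp (r * x) * ∫ t in Set.Ioi x, Real.exp (-r * t) * h t

section expAvg

variable {r : ℝ} {h k : ℝ → ℝ} {C : ℝ}

theorem integrableOn_exp_mul (hr : 0 < r) (hh : Continuous h) (hC : ∀ x, |h x| ≤ C) (x : ℝ) :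
    IntegrableOn (fun t => Real.exp (-r * t) * h t) (Set.Ioi x) := by
  have h1 : IntegrableOn (fun t => Real.exp (-r * t)) (Set.Ioi x) :=
    integrableOn_exp_mul_Ioi (by linarith) x
  exact h1.mul_bdd hh.aestronglyMeasurable (Eventually.of_forall hC)

theorem expAvg_hasDerivAt (hr : 0 < r) (hh : Continuous h) (hC : ∀ x, |h x| ≤ C) (x : ℝ) :
    HasDerivAt (expAvg r h) (r * expAvg r h x - h x) x := by
  have hcont : Continuous fun t => Real.exp (-r * t) * h t := by fun_prop
  have e : expAvg r h = fun x => Real.exp (r * x) *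
      ((∫ t in Set.Ioi 0, Real.exp (-r * t) * h t) - ∫ t in (0 : ℝ)..x, Real.exp (-r * t) * h t) := by
    ext y
    rw [expAvg, ← intervalIntegral.integral_Ioi_sub_Ioi' (integrableOn_exp_mul hr hh hC 0)
      (integrableOn_exp_mul hr hh hC y), sub_sub_cancel]
  have h1 : HasDerivAt (fun x => Real.exp (r * x)) (Real.exp (r * x) * (r * 1)) x :=
    ((hasDerivAt_id x).const_mul r).exp
  have h2 := (hcont.integral_hasStrictDerivAt 0 x).hasDerivAt.const_sub
    (∫ t in Set.Ioi 0, Real.exp (-r * t) * h t)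
  have h3 := h1.mul h2
  rw [e]
  refine h3.congr_deriv ?_
  have : Real.exp (r * x) * Real.exp (-r * x) = 1 := by rw [← Real.exp_add]; simp
  linear_combination (-h x) * this

theorem expAvg_const (hr : 0 < r) (c x : ℝ) : expAvg r (fun _ => c) x = c / r := by
  rw [expAvg, integral_mul_const, integral_exp_mul_Ioi (by linarith)]
  have : Real.exp (r * x) * Real.exp (-r * x) = 1 := by rw [← Real.exp_add]; simp
  rw [neg_mul] at this
  field_simp
  linear_combination c * this

theorem expAvg_mono {D : ℝ} (hr : 0 < r) (hh : Continuous h) (hC : ∀ x, |h x| ≤ C)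
    (hk : Continuous k) (hD : ∀ x, |k x| ≤ D) (hhk : ∀ x, h x ≤ k x) (x : ℝ) :
    expAvg r h x ≤ expAvg r k x := by
  refine mul_le_mul_of_nonneg_left ?_ (Real.exp_pos _).le
  refine setIntegral_mono (integrableOn_exp_mul hr hh hC x) (integrableOn_exp_mul hr hk hD x) ?_
  exact fun t => mul_le_mul_of_nonneg_left (hhk t) (Real.exp_pos _).le

theorem expAvg_sub {D : ℝ} (hr : 0 < r) (hh : Continuous h) (hC : ∀ x, |h x| ≤ C)
    (hk : Continuous k) (hD : ∀ x, |k x| ≤ D) (x : ℝ) :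
    expAvg r h x - expAvg r k x = expAvg r (fun t => h t - k t) x := by
  rw [expAvg, expAvg, expAvg, ← mul_sub, ← integral_sub (integrableOn_exp_mul hr hh hC x)
    (integrableOn_exp_mul hr hk hD x)]
  simp only [mul_sub]

theorem abs_expAvg_le (hr : 0 < r) (hh : Continuous h) (hC : ∀ x, |h x| ≤ C) (x : ℝ) :
    |expAvg r h x| ≤ C / r := by
  rw [abs_le, ← neg_div, ← expAvg_const hr C x, ← expAvg_const hr (-C) x]
  exact ⟨expAvg_mono hr continuous_const (fun _ => le_rfl) hh hC (fun t => (abs_le.1 (hC t)).1) x,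
    expAvg_mono hr hh hC continuous_const (fun _ => le_rfl) (fun t => (abs_le.1 (hC t)).2) x⟩

end expAvg

/-- The Riccati equation `p' = p² - V` has a global solution between `c` and `d`. -/
theorem exists_riccati {V : ℝ → ℝ} (hV : Continuous V) {c d : ℝ} (hc : 0 < c) (hcd : c ≤ d)
    (hb : ∀ x, c ^ 2 ≤ V x ∧ V x ≤ d ^ 2) :
    ∃ p : ℝ → ℝ, (∀ x, HasDerivAt p (p x ^ 2 - V x) x) ∧ ∀ x, c ≤ p x ∧ p x ≤ d := by
  have hd : 0 < d := hc.trans_le hcd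
  have hr : 0 < 2 * d := by linarith
  let S : Set (ℝ →ᵇ ℝ) := {f | ∀ x, f x ∈ Set.Icc c d}
  have hS : IsClosed S := by
    simp only [S, Set.ofPred_forall]
    exact isClosed_iInter fun x => isClosed_Icc.preimage (by fun_prop)
  have : CompleteSpace S := hS.completeSpace_coe
  have : Nonempty S :=
    ⟨⟨BoundedContinuousFunction.const ℝ c, fun x => ⟨le_rfl, hcd⟩⟩⟩
  -- The equation reads p' = 2d p - H p, so p must be a fixed point of f ↦ `expAvg (2 * d) (H f)`.
  -- The shift 2d makes t ↦ 2dt - t² increasing on [c, d]; hence 2dc ≤ H f ≤ 2d², and dividing by 2d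
  -- shows that [c, d] is preserved.
  let H : S → ℝ → ℝ := fun f x => V x + 2 * d * f.1 x - f.1 x ^ 2
  have hHc (f : S) : Continuous (H f) := by
    have := f.1.continuous
    simp only [H]; fun_prop
  have hHb (f : S) (x : ℝ) : 2 * d * c ≤ H f x ∧ H f x ≤ 2 * d * d := by
    have h1 := f.2 x
    have h2 := hb x
    simp only [H]
    constructor <;> nlinarith [h1.1, h1.2]
  have hHa (f : S) (x : ℝ) : |H f x| ≤ 2 * d * d :=
    abs_le.2 ⟨by nlinarith [hHb f x], (hHb f x).2⟩
  have hmem (f : S) (x : ℝ) : expAvg (2 * d) (H f) x ∈ Set.Icc c d := by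
    have e1 := expAvg_const hr (2 * d * c) x
    have e2 := expAvg_const hr (2 * d * d) x
    rw [mul_div_cancel_left₀ _ hr.ne'] at e1 e2
    constructor
    · rw [← e1]
      exact expAvg_mono hr continuous_const (fun _ => le_rfl) (hHc f) (hHa f)
        (fun t => (hHb f t).1) x
    · conv_rhs => rw [← e2]
      exact expAvg_mono hr (hHc f) (hHa f) continuous_const (fun _ => le_rfl)
        (fun t => (hHb f t).2) x
  have hder (f : S) (x : ℝ) := expAvg_hasDerivAt hr (hHc f) (hHa f) x
  let T : S → S := fun f => ⟨BoundedContinuousFunction.ofNormedAddCommGroup (expAvg (2 * d) (H f))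
    (continuous_iff_continuousAt.2 fun x => (hder f x).continuousAt) d
    (fun x => by
      rw [Real.norm_eq_abs, abs_of_nonneg (hc.le.trans (hmem f x).1)]; exact (hmem f x).2),
    hmem f⟩
  -- H f - H g = (2d - (f + g))(f - g) with f + g between 2c and 2d, and `expAvg (2 * d)` gains a
  -- factor 1/(2d). The ratio is below 1 because c > 0.
  have hT : ContractingWith (Real.toNNReal ((2 * d - 2 * c) / (2 * d))) T := by
    have hK : 0 ≤ (2 * d - 2 * c) / (2 * d) := div_nonneg (by linarith) hr.le
    refine ⟨?_, LipschitzWith.of_dist_le_mul fun f g => ?_⟩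
    · rw [← NNReal.coe_lt_coe, Real.coe_toNNReal _ hK, NNReal.coe_one, div_lt_one hr]
      linarith
    · rw [Real.coe_toNNReal _ hK, Subtype.dist_eq,
        BoundedContinuousFunction.dist_le (mul_nonneg hK dist_nonneg)]
      intro x
      change dist (expAvg (2 * d) (H f) x) (expAvg (2 * d) (H g) x) ≤ _
      rw [Real.dist_eq, expAvg_sub hr (hHc f) (hHa f) (hHc g) (hHa g), div_mul_eq_mul_div]
      refine abs_expAvg_le hr ((hHc f).sub (hHc g)) (fun t => ?_) x
      have e : H f t - H g t = (2 * d - (f.1 t + g.1 t)) * (f.1 t - g.1 t) := by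
        simp only [H]; ring
      have hf := f.2 t
      have hg := g.2 t
      rw [Pi.sub_apply, e, abs_mul, abs_of_nonneg (by linarith [hf.2, hg.2])]
      refine mul_le_mul (by linarith [hf.1, hg.1]) ?_ (abs_nonneg _) (by linarith)
      rw [← Real.dist_eq]
      exact BoundedContinuousFunction.dist_coe_le_dist t
  let p : S := hT.fixedPoint T
  have hp : T p = p := hT.fixedPoint_isFixedPt
  have hp' : expAvg (2 * d) (H p) = p.1 := by
    conv_rhs => rw [← hp]
    rfl
  refine ⟨p.1, fun x => ?_, fun x => p.2 x⟩
  have := hder p x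
  rw [hp'] at this
  refine this.congr_deriv ?_
  simp only [H]; ring

/-! ### The fundamental theorem of calculus on half-lines. -/

section improper

variable {f : ℝ → ℝ}

/-- Integrability of the derivative gives a limit; integrability of f forces that limit to be 0,
since half-lines have infinite measure. -/
theorem LocallyAC.tendsto_atTop_of_integrable (hf : LocallyAC f) (hi : Integrable f)
    (hd : Integrable (deriv f)) : Tendsto f atTop (𝓝 0) := by
  have h := (intervalIntegral_tendsto_integral_Ioi 0 hd.integrableOn tendsto_id).const_add (f 0)
  have h' : Tendsto f atTop (𝓝 (f 0 + ∫ x in Set.Ioi 0, deriv f x)) := by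
    refine h.congr fun b => ?_
    rw [id, (hf 0 b).integral_deriv_eq_sub]; ring
  have h0 : f 0 + ∫ x in Set.Ioi 0, deriv f x = 0 := by
    refine IntegrableAtFilter.eq_zero_of_tendsto (μ := volume) (l := atTop)
      ⟨Set.univ, univ_mem, hi.integrableOn⟩ ?_ h'
    intro s hs
    rcases mem_atTop_sets.1 hs with ⟨b, hb⟩
    rw [← top_le_iff, ← Real.volume_Ici (a := b)]
    exact measure_mono hb
  rwa [h0] at h'

theorem LocallyAC.tendsto_atBot_of_integrable (hf : LocallyAC f) (hi : Integrable f)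
    (hd : Integrable (deriv f)) : Tendsto f atBot (𝓝 0) := by
  have h := (intervalIntegral_tendsto_integral_Iic 0 hd.integrableOn tendsto_id).const_sub (f 0)
  have h' : Tendsto f atBot (𝓝 (f 0 - ∫ x in Set.Iic 0, deriv f x)) := by
    refine h.congr fun b => ?_
    rw [(hf _ 0).integral_deriv_eq_sub, id]; ring
  have h0 : f 0 - ∫ x in Set.Iic 0, deriv f x = 0 := by
    refine IntegrableAtFilter.eq_zero_of_tendsto (μ := volume) (l := atBot)
      ⟨Set.univ, univ_mem, hi.integrableOn⟩ ?_ h'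
    intro s hs
    rcases mem_atBot_sets.1 hs with ⟨b, hb⟩
    rw [← top_le_iff, ← Real.volume_Iic (a := b)]
    exact measure_mono hb
  rwa [h0] at h'

theorem LocallyAC.integral_Ioi_deriv (hf : LocallyAC f) (hi : Integrable f)
    (hd : Integrable (deriv f)) (a : ℝ) : ∫ x in Set.Ioi a, deriv f x = -f a := by
  refine tendsto_nhds_unique
    (intervalIntegral_tendsto_integral_Ioi a hd.integrableOn tendsto_id) ?_
  rw [← zero_sub]
  refine ((hf.tendsto_atTop_of_integrable hi hd).sub_const (f a)).congr fun b => ?_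
  rw [(hf a _).integral_deriv_eq_sub, id]

theorem LocallyAC.integral_Iic_deriv (hf : LocallyAC f) (hi : Integrable f)
    (hd : Integrable (deriv f)) (a : ℝ) : ∫ x in Set.Iic a, deriv f x = f a := by
  refine tendsto_nhds_unique
    (intervalIntegral_tendsto_integral_Iic a hd.integrableOn tendsto_id) ?_
  rw [← sub_zero (f a)]
  refine ((hf.tendsto_atBot_of_integrable hi hd).const_sub (f a)).congr fun b => ?_
  rw [(hf _ a).integral_deriv_eq_sub, id]

end improper

/-- `p` and `-q` are solutions of the Riccati equation `y' = y² - V` with `p` and `q` between the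
positive constants `c` and `d`. -/
structure IsRiccatiPair (V p q : ℝ → ℝ) (c d : ℝ) : Prop where
  pos : 0 < c
  cont : Continuous V
  bound : ∀ x, c ^ 2 ≤ V x ∧ V x ≤ d ^ 2
  hasDerivAt_left : ∀ x, HasDerivAt p (p x ^ 2 - V x) x
  hasDerivAt_right : ∀ x, HasDerivAt q (V x - q x ^ 2) x
  bound_left : ∀ x, c ≤ p x ∧ p x ≤ d
  bound_right : ∀ x, c ≤ q x ∧ q x ≤ d

/-- Reflection x ↦ -x turns the equation of p, for the reflected potential, into that of q. -/
theorem exists_isRiccatiPair {V : ℝ → ℝ} (hV : Continuous V) {c d : ℝ} (hc : 0 < c) (hcd : c ≤ d)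
    (hb : ∀ x, c ^ 2 ≤ V x ∧ V x ≤ d ^ 2) : ∃ p q, IsRiccatiPair V p q c d := by
  obtain ⟨p, hp, hpb⟩ := exists_riccati hV hc hcd hb
  obtain ⟨q, hq, hqb⟩ := exists_riccati (hV.comp continuous_neg) hc hcd (fun x => hb (-x))
  refine ⟨p, fun x => q (-x), hc, hV, hb, hp, fun x => ?_, hpb, fun x => hqb (-x)⟩
  have := (hq (-x)).comp x (hasDerivAt_neg x)
  refine this.congr_deriv ?_
  simp only [Function.comp_apply, neg_neg]; ring

/-! ### Completing the square in the energy. -/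

namespace MemH1

variable {u V p : ℝ → ℝ} {d : ℝ}

theorem locallyAC (hu : MemH1 u) : LocallyAC u := (memH1_iff.1 hu).1

theorem integrable_sq (hu : MemH1 u) : Integrable fun x => u x ^ 2 := hu.2.1.integrable_sq

theorem integrable_deriv_sq (hu : MemH1 u) : Integrable fun x => deriv u x ^ 2 :=
  (memH1_iff.1 hu).2.2.integrable_sq

theorem integrable_mul_deriv (hu : MemH1 u) : Integrable fun x => u x * deriv u x :=
  hu.2.1.integrable_mul (memH1_iff.1 hu).2.2

theorem integrable_bdd_mul_sq (hu : MemH1 u) (hV : Continuous V) (hb : ∀ x, |V x| ≤ d) :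
    Integrable fun x => V x * u x ^ 2 :=
  hu.integrable_sq.bdd_mul hV.aestronglyMeasurable (Eventually.of_forall hb)

theorem integrable_energy (hu : MemH1 u) (hV : Continuous V) (hb : ∀ x, |V x| ≤ d) :
    Integrable fun x => deriv u x ^ 2 + V x * u x ^ 2 :=
  hu.integrable_deriv_sq.add (hu.integrable_bdd_mul_sq hV hb)

theorem deriv_mul_sq (hu : MemH1 u) (hp : Differentiable ℝ p) :
    deriv (fun x => p x * (u x * u x)) =ᵐ[volume]
      fun x => deriv p x * u x ^ 2 + 2 * (p x * (u x * deriv u x)) := by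
  filter_upwards [hu.locallyAC.ae_differentiableAt] with x hx
  have := (hp x).hasDerivAt.mul (hx.hasDerivAt.mul hx.hasDerivAt)
  refine Eq.trans this.deriv ?_
  simp only [Pi.mul_apply]; ring

/-- Completing the square in the energy by a bounded solution of the Riccati equation. -/
theorem setIntegral_energy (hu : MemH1 u) (hV : Continuous V)
    (hp : ∀ x, HasDerivAt p (p x ^ 2 - V x) x) (hVb : ∀ x, |V x| ≤ d ^ 2) (hpb : ∀ x, |p x| ≤ d)
    (a : ℝ) :
    Integrable (fun x => (deriv u x + p x * u x) ^ 2) ∧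
    (∫ x in Set.Ioi a, (deriv u x ^ 2 + V x * u x ^ 2)) =
      (∫ x in Set.Ioi a, (deriv u x + p x * u x) ^ 2) + p a * u a ^ 2 ∧
    (∫ x in Set.Iic a, (deriv u x ^ 2 + V x * u x ^ 2)) =
      (∫ x in Set.Iic a, (deriv u x + p x * u x) ^ 2) - p a * u a ^ 2 := by
  have hpd : Differentiable ℝ p := fun x => (hp x).differentiableAt
  have hderiv : deriv p = fun x => p x ^ 2 - V x := funext fun x => (hp x).deriv
  have hpc : Continuous p := hpd.continuous
  have hdc : Continuous fun x => p x ^ 2 - V x := (hpc.pow 2).sub hV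
  have hdb (x : ℝ) : |p x ^ 2 - V x| ≤ d ^ 2 + d ^ 2 := by
    refine (abs_sub _ _).trans (add_le_add ?_ (hVb x))
    rw [abs_pow]
    exact pow_le_pow_left₀ (abs_nonneg _) (hpb x) 2
  set f : ℝ → ℝ := fun x => p x * (u x * u x) with hf
  have hfac : LocallyAC f :=
    (LocallyAC.of_contDiff (contDiff_one_iff_deriv.2 ⟨hpd, by rwa [hderiv]⟩)).mul
      (hu.locallyAC.mul hu.locallyAC)
  have hfi : Integrable f := by
    simpa only [hf, ← sq] using hu.integrable_bdd_mul_sq hpc hpb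
  have hfd : deriv f =ᵐ[volume] fun x =>
      (p x ^ 2 - V x) * u x ^ 2 + 2 * (p x * (u x * deriv u x)) := by
    have := hu.deriv_mul_sq hpd
    rwa [hderiv] at this
  have hfdi : Integrable (deriv f) := by
    refine Integrable.congr ?_ hfd.symm
    exact (hu.integrable_bdd_mul_sq hdc hdb).add
      ((hu.integrable_mul_deriv.bdd_mul hpc.aestronglyMeasurable
        (Eventually.of_forall hpb)).const_mul 2)
  have hE := hu.integrable_energy hV hVb
  -- The Riccati equation enters here: it turns the energy density plus the derivative of p u² into
  -- a perfect square.
  have hsq : (fun x => (deriv u x ^ 2 + V x * u x ^ 2) + deriv f x) =ᵐ[volume]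
      fun x => (deriv u x + p x * u x) ^ 2 := by
    filter_upwards [hfd] with x hx
    rw [hx]; ring
  refine ⟨(hE.add hfdi).congr hsq, ?_, ?_⟩
  · rw [← integral_congr_ae (ae_restrict_of_ae hsq),
      integral_add hE.integrableOn hfdi.integrableOn, hfac.integral_Ioi_deriv hfi hfdi]
    simp only [hf]; ring
  · rw [← integral_congr_ae (ae_restrict_of_ae hsq),
      integral_add hE.integrableOn hfdi.integrableOn, hfac.integral_Iic_deriv hfi hfdi]
    simp only [hf]; ring

end MemH1

namespace IsRiccatiPair

variable {u V p q : ℝ → ℝ} {c d : ℝ}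

theorem abs_le_sq (h : IsRiccatiPair V p q c d) (x : ℝ) : |V x| ≤ d ^ 2 := by
  rw [abs_of_nonneg ((sq_nonneg c).trans (h.bound x).1)]; exact (h.bound x).2

theorem abs_left_le (h : IsRiccatiPair V p q c d) (x : ℝ) : |p x| ≤ d := by
  rw [abs_of_nonneg (h.pos.le.trans (h.bound_left x).1)]; exact (h.bound_left x).2

theorem abs_right_le (h : IsRiccatiPair V p q c d) (x : ℝ) : |q x| ≤ d := by
  rw [abs_of_nonneg (h.pos.le.trans (h.bound_right x).1)]; exact (h.bound_right x).2

theorem continuous_left (h : IsRiccatiPair V p q c d) : Continuous p :=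
  continuous_iff_continuousAt.2 fun x => (h.hasDerivAt_left x).continuousAt

theorem continuous_right (h : IsRiccatiPair V p q c d) : Continuous q :=
  continuous_iff_continuousAt.2 fun x => (h.hasDerivAt_right x).continuousAt

theorem hasDerivAt_neg_right (h : IsRiccatiPair V p q c d) (x : ℝ) :
    HasDerivAt (fun x => -q x) ((-q x) ^ 2 - V x) x :=
  (h.hasDerivAt_right x).neg.congr_deriv (by ring)

theorem integrable_left (h : IsRiccatiPair V p q c d) (hu : MemH1 u) :
    Integrable fun x => (deriv u x + p x * u x) ^ 2 :=
  (hu.setIntegral_energy h.cont h.hasDerivAt_left h.abs_le_sq h.abs_left_le 0).1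

theorem integrable_right (h : IsRiccatiPair V p q c d) (hu : MemH1 u) :
    Integrable fun x => (deriv u x + -q x * u x) ^ 2 :=
  (hu.setIntegral_energy h.cont h.hasDerivAt_neg_right h.abs_le_sq
    (fun x => by rw [abs_neg]; exact h.abs_right_le x) 0).1

/-- Using p after a and -q before a makes both boundary terms at a positive, so they add up to a
sharp lower bound. -/
theorem energy_eq (h : IsRiccatiPair V p q c d) (hu : MemH1 u) (a : ℝ) :
    energy V u = (∫ x in Set.Ioi a, (deriv u x + p x * u x) ^ 2) +
      (∫ x in Set.Iic a, (deriv u x + -q x * u x) ^ 2) + (p a + q a) * u a ^ 2 := by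
  rw [hu.energy_eq, ← intervalIntegral.integral_Iic_add_Ioi (b := a)
      (hu.integrable_energy h.cont h.abs_le_sq).integrableOn
      (hu.integrable_energy h.cont h.abs_le_sq).integrableOn,
    (hu.setIntegral_energy h.cont h.hasDerivAt_left h.abs_le_sq h.abs_left_le a).2.1,
    (hu.setIntegral_energy h.cont h.hasDerivAt_neg_right h.abs_le_sq
      (fun x => by rw [abs_neg]; exact h.abs_right_le x) a).2.2]
  ring

theorem le_energy (h : IsRiccatiPair V p q c d) (hu : MemH1 u) (a : ℝ) :
    (p a + q a) * u a ^ 2 ≤ energy V u := by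
  rw [h.energy_eq hu a]
  have h1 : 0 ≤ ∫ x in Set.Ioi a, (deriv u x + p x * u x) ^ 2 :=
    integral_nonneg fun x => sq_nonneg _
  have h2 : 0 ≤ ∫ x in Set.Iic a, (deriv u x + -q x * u x) ^ 2 :=
    integral_nonneg fun x => sq_nonneg _
  linarith

theorem energy_eq_iff (h : IsRiccatiPair V p q c d) (hu : MemH1 u) (a : ℝ) :
    energy V u = (p a + q a) * u a ^ 2 ↔
      (∀ᵐ x, a < x → deriv u x + p x * u x = 0) ∧
      (∀ᵐ x, x ≤ a → deriv u x + -q x * u x = 0) := by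
  have h1 : 0 ≤ ∫ x in Set.Ioi a, (deriv u x + p x * u x) ^ 2 :=
    integral_nonneg fun x => sq_nonneg _
  have h2 : 0 ≤ ∫ x in Set.Iic a, (deriv u x + -q x * u x) ^ 2 :=
    integral_nonneg fun x => sq_nonneg _
  have e1 : (∫ x in Set.Ioi a, (deriv u x + p x * u x) ^ 2) = 0 ↔
      ∀ᵐ x, a < x → deriv u x + p x * u x = 0 := by
    rw [integral_eq_zero_iff_of_nonneg (fun x => sq_nonneg _) (h.integrable_left hu).integrableOn,
      Filter.EventuallyEq, ae_restrict_iff' measurableSet_Ioi]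
    simp
  have e2 : (∫ x in Set.Iic a, (deriv u x + -q x * u x) ^ 2) = 0 ↔
      ∀ᵐ x, x ≤ a → deriv u x + -q x * u x = 0 := by
    rw [integral_eq_zero_iff_of_nonneg (fun x => sq_nonneg _) (h.integrable_right hu).integrableOn,
      Filter.EventuallyEq, ae_restrict_iff' measurableSet_Iic]
    simp
  rw [← e1, ← e2, h.energy_eq hu a]
  constructor
  · intro h3; constructor <;> linarith
  · rintro ⟨h3, h4⟩; rw [h3, h4]; ring

end IsRiccatiPair

/-! ### The extremal profile. -/

/-- The function with logarithmic derivative `q` before `a` and `-p` after `a`, and value `1`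
at `a`. -/
noncomputable def profile (p q : ℝ → ℝ) (a x : ℝ) : ℝ :=
  min (Real.exp (-∫ t in a..x, p t)) (Real.exp (∫ t in a..x, q t))

theorem mul_le_integral {q : ℝ → ℝ} {c : ℝ} (hq : Continuous q) (hc : ∀ x, c ≤ q x) {x y : ℝ}
    (hxy : x ≤ y) : c * (y - x) ≤ ∫ t in x..y, q t := by
  have := intervalIntegral.integral_mono_on (μ := volume) hxy (intervalIntegrable_const (c := c))
    (hq.intervalIntegrable x y) (fun t _ => hc t)
  rwa [intervalIntegral.integral_const, smul_eq_mul, mul_comm] at this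

theorem profile_self (p q : ℝ → ℝ) (a : ℝ) : profile p q a a = 1 := by
  simp [profile]

theorem profile_pos (p q : ℝ → ℝ) (a x : ℝ) : 0 < profile p q a x :=
  lt_min (Real.exp_pos _) (Real.exp_pos _)

theorem ae_ne (a : ℝ) : ∀ᵐ x : ℝ, x ≠ a := by simp [ae_iff, measure_singleton]

theorem mul_profile_ne_zero {p q : ℝ → ℝ} {k : ℝ} (hk : k ≠ 0) (a : ℝ) :
    (fun x => k * profile p q a x) ≠ 0 := fun h0 => by
  have := congrFun h0 a
  simp only [profile_self, mul_one, Pi.zero_apply] at this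
  exact hk this

theorem hasDerivAt_exp_integral {q : ℝ → ℝ} (hq : Continuous q) (a x : ℝ) :
    HasDerivAt (fun x => Real.exp (∫ t in a..x, q t)) (q x * Real.exp (∫ t in a..x, q t)) x := by
  have := (hq.integral_hasStrictDerivAt a x).hasDerivAt.exp
  exact this.congr_deriv (mul_comm _ _)

theorem contDiff_exp_integral {q : ℝ → ℝ} (hq : Continuous q) (a : ℝ) :
    ContDiff ℝ 1 (fun x => Real.exp (∫ t in a..x, q t)) := by
  have h := hasDerivAt_exp_integral hq a
  have hd : Differentiable ℝ (fun x => Real.exp (∫ t in a..x, q t)) :=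
    fun x => (h x).differentiableAt
  refine contDiff_one_iff_deriv.2 ⟨hd, ?_⟩
  rw [show deriv (fun x => Real.exp (∫ t in a..x, q t)) = _ from funext fun x => (h x).deriv]
  exact hq.mul hd.continuous

theorem integral_exp_neg_eq {p : ℝ → ℝ} (a x : ℝ) :
    Real.exp (-∫ t in a..x, p t) = Real.exp (∫ t in a..x, -p t) := by
  rw [intervalIntegral.integral_neg]

theorem LocallyAC.of_locallyLipschitz {u : ℝ → ℝ} (hu : LocallyLipschitz u) : LocallyAC u := by
  intro a b
  obtain ⟨K, hK⟩ := (hu.locallyLipschitzOn (s := Set.uIcc a b)).exists_lipschitzOnWith_of_compact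
    isCompact_uIcc
  exact hK.absolutelyContinuousOnInterval

theorem integrable_exp_neg_mul_abs {c : ℝ} (hc : 0 < c) (a : ℝ) :
    Integrable fun x => Real.exp (-c * |x - a|) := by
  have h0 : Integrable fun x : ℝ => Real.exp (-c * |x|) := by
    rw [← integrableOn_univ, ← Set.Iic_union_Ioi (a := (0 : ℝ))]
    refine IntegrableOn.union ?_ ?_
    · refine (integrableOn_exp_mul_Iic hc 0).congr_fun (fun x hx => ?_) measurableSet_Iic
      simp only [abs_of_nonpos (Set.mem_Iic.1 hx)]
      congr 1; ring
    · refine (integrableOn_exp_mul_Ioi (neg_neg_of_pos hc) 0).congr_fun (fun x hx => ?_)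
        measurableSet_Ioi
      simp only [abs_of_pos (Set.mem_Ioi.1 hx)]
  exact h0.comp_sub_right a

namespace IsRiccatiPair

variable {u V p q : ℝ → ℝ} {c d : ℝ}

/-- As p and q are positive, the exponential with p is at most 1 after a and the one with q is at
least 1, so the minimum selects the intended branch. -/
theorem profile_of_ge (h : IsRiccatiPair V p q c d) {a x : ℝ} (hx : a ≤ x) :
    profile p q a x = Real.exp (-∫ t in a..x, p t) := by
  refine min_eq_left (Real.exp_le_exp.2 ?_)
  have h1 := mul_le_integral h.continuous_left (fun t => h.pos.le.trans (h.bound_left t).1) hx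
  have h2 := mul_le_integral h.continuous_right (fun t => h.pos.le.trans (h.bound_right t).1) hx
  linarith

theorem profile_of_le (h : IsRiccatiPair V p q c d) {a x : ℝ} (hx : x ≤ a) :
    profile p q a x = Real.exp (∫ t in a..x, q t) := by
  refine min_eq_right (Real.exp_le_exp.2 ?_)
  have h1 := mul_le_integral h.continuous_left (fun t => h.pos.le.trans (h.bound_left t).1) hx
  have h2 := mul_le_integral h.continuous_right (fun t => h.pos.le.trans (h.bound_right t).1) hx
  rw [intervalIntegral.integral_symm x a, intervalIntegral.integral_symm x a]
  linarith

theorem profile_le (h : IsRiccatiPair V p q c d) (a x : ℝ) :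
    profile p q a x ≤ Real.exp (-c * |x - a|) := by
  rcases le_total a x with hx | hx
  · rw [h.profile_of_ge hx, Real.exp_le_exp, abs_of_nonneg (sub_nonneg.2 hx)]
    linarith [mul_le_integral h.continuous_left (fun t => (h.bound_left t).1) hx]
  · rw [h.profile_of_le hx, Real.exp_le_exp, abs_of_nonpos (sub_nonpos.2 hx),
      intervalIntegral.integral_symm]
    linarith [mul_le_integral h.continuous_right (fun t => (h.bound_right t).1) hx]

theorem profile_le_one (h : IsRiccatiPair V p q c d) (a x : ℝ) : profile p q a x ≤ 1 := by
  refine (h.profile_le a x).trans (Real.exp_le_one_iff.2 ?_)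
  nlinarith [h.pos, abs_nonneg (x - a)]

/-- A minimum of two C¹ functions is locally Lipschitz, so no gluing at a is needed. -/
theorem profile_locallyAC (h : IsRiccatiPair V p q c d) (a : ℝ) : LocallyAC (profile p q a) := by
  refine LocallyAC.of_locallyLipschitz (LocallyLipschitz.min ?_ ?_)
  · simp only [integral_exp_neg_eq]
    exact (contDiff_exp_integral h.continuous_left.fun_neg a).locallyLipschitz
  · exact (contDiff_exp_integral h.continuous_right a).locallyLipschitz

theorem deriv_profile_of_gt (h : IsRiccatiPair V p q c d) {a x : ℝ} (hx : a < x) :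
    deriv (profile p q a) x = -p x * profile p q a x := by
  rw [h.profile_of_ge hx.le, integral_exp_neg_eq]
  refine ((hasDerivAt_exp_integral h.continuous_left.fun_neg a x).congr_of_eventuallyEq ?_).deriv
  filter_upwards [lt_mem_nhds hx] with y hy
  rw [h.profile_of_ge hy.le, integral_exp_neg_eq]

theorem deriv_profile_of_lt (h : IsRiccatiPair V p q c d) {a x : ℝ} (hx : x < a) :
    deriv (profile p q a) x = q x * profile p q a x := by
  rw [h.profile_of_le hx.le]
  refine ((hasDerivAt_exp_integral h.continuous_right a x).congr_of_eventuallyEq ?_).deriv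
  filter_upwards [gt_mem_nhds hx] with y hy
  rw [h.profile_of_le hy.le]

/-- The profile decays like exp(-c|x - a|), and off a its derivative is at most d times the profile.
-/
theorem memH1_profile (h : IsRiccatiPair V p q c d) (a : ℝ) : MemH1 (profile p q a) := by
  have hac := h.profile_locallyAC a
  have h2 : MemLp (profile p q a) 2 := by
    rw [memLp_two_iff_integrable_sq hac.continuous.aestronglyMeasurable]
    refine (integrable_exp_neg_mul_abs h.pos a).mono'
      (hac.continuous.pow 2).aestronglyMeasurable (Eventually.of_forall fun x => ?_)
    rw [Real.norm_eq_abs, abs_of_nonneg (sq_nonneg _)]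
    refine le_trans ?_ (h.profile_le a x)
    nlinarith [h.profile_le_one a x, profile_pos p q a x]
  refine memH1_iff.2 ⟨hac, h2, h2.of_le_mul (c := d) (measurable_deriv _).aestronglyMeasurable ?_⟩
  filter_upwards [ae_ne a] with x hx
  rcases lt_or_gt_of_ne hx with hx | hx
  · rw [h.deriv_profile_of_lt hx, norm_mul]
    exact mul_le_mul_of_nonneg_right (h.abs_right_le x) (norm_nonneg _)
  · rw [h.deriv_profile_of_gt hx, norm_mul, norm_neg]
    exact mul_le_mul_of_nonneg_right (h.abs_left_le x) (norm_nonneg _)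

theorem energy_profile (h : IsRiccatiPair V p q c d) (a : ℝ) :
    energy V (profile p q a) = p a + q a := by
  have := (h.energy_eq_iff (h.memH1_profile a) a).2 ⟨?_, ?_⟩
  · rw [this, profile_self]; ring
  · exact Eventually.of_forall fun x hx => by rw [h.deriv_profile_of_gt hx]; ring
  · filter_upwards [ae_ne a] with x hx hxa
    rw [h.deriv_profile_of_lt (lt_of_le_of_ne hxa hx)]; ring

/-- Equality in `le_energy` holds only for multiples of `profile p q a`. -/
theorem eq_mul_profile (h : IsRiccatiPair V p q c d) (hu : MemH1 u) {a : ℝ}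
    (he : energy V u = (p a + q a) * u a ^ 2) : u = fun x => u a * profile p q a x := by
  obtain ⟨h1, h2⟩ := (h.energy_eq_iff hu a).1 he
  have hac := hu.locallyAC
  have hne := ae_ne a
  ext x
  rcases le_total a x with hx | hx
  · rw [h.profile_of_ge hx]
    -- Integrating factor: u exp(∫ p) is absolutely continuous with zero derivative a.e., hence
    -- constant.
    obtain ⟨C, hC⟩ := (((hac a x).fun_mul (LocallyAC.of_contDiff
        (contDiff_exp_integral h.continuous_left a) a x))).const_of_ae_hasDerivAt_zero (by
      filter_upwards [h1, hac.ae_differentiableAt, hne] with t ht htd hta htm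
      rw [Set.uIcc_of_le hx] at htm
      have := htd.hasDerivAt.mul (hasDerivAt_exp_integral h.continuous_left a t)
      refine this.congr_deriv ?_
      linear_combination (Real.exp (∫ t in a..t, p t)) * ht (lt_of_le_of_ne htm.1 hta.symm))
    have ha := hC a (by simp)
    rw [← hC x (by simp)] at ha
    simp only [intervalIntegral.integral_same, Real.exp_zero, mul_one] at ha
    rw [ha, mul_assoc, ← Real.exp_add]; simp
  · rw [h.profile_of_le hx]
    obtain ⟨C, hC⟩ := (((hac a x).fun_mul (LocallyAC.of_contDiff
        (contDiff_exp_integral h.continuous_right.fun_neg a) a x))).const_of_ae_hasDerivAt_zero (by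
      filter_upwards [h2, hac.ae_differentiableAt] with t ht htd htm
      rw [Set.uIcc_of_ge hx] at htm
      have := htd.hasDerivAt.mul (hasDerivAt_exp_integral h.continuous_right.fun_neg a t)
      refine this.congr_deriv ?_
      linear_combination (Real.exp (∫ t in a..t, -q t)) * ht htm.2)
    have ha := hC a (by simp)
    rw [← hC x (by simp)] at ha
    simp only [intervalIntegral.integral_same, Real.exp_zero, mul_one] at ha
    rw [ha, intervalIntegral.integral_neg, mul_assoc, ← Real.exp_add]; simp

end IsRiccatiPair

/-! ### Attainment of the sup norm, and the formulas for F, m and M. -/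

theorem supNorm_eq_of_forall_le {u : ℝ → ℝ} (hu : Continuous u) {a : ℝ}
    (h : ∀ x, |u x| ≤ |u a|) : supNorm u = |u a| := by
  have h1 : eLpNormEssSup u volume ≤ ENNReal.ofReal |u a| :=
    eLpNormEssSup_le_of_ae_bound (Eventually.of_forall h)
  have h2 : ‖u a‖ₑ ≤ eLpNormEssSup u volume := by
    have hd := Measure.dense_of_ae (enorm_ae_le_eLpNormEssSup u (volume : Measure ℝ))
    have hc : IsClosed {x | ‖u x‖ₑ ≤ eLpNormEssSup u volume} :=
      isClosed_le hu.enorm continuous_const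
    have : a ∈ closure {x | ‖u x‖ₑ ≤ eLpNormEssSup u volume} := hd a
    rwa [hc.closure_eq] at this
  rw [← ofReal_norm, Real.norm_eq_abs] at h2
  rw [supNorm, eLpNorm_exponent_top, le_antisymm h1 h2, ENNReal.toReal_ofReal (abs_nonneg _)]

theorem LocallyAC.const_mul {u : ℝ → ℝ} (hu : LocallyAC u) (k : ℝ) :
    LocallyAC (fun x => k * u x) := fun a b => (hu a b).const_mul k

namespace MemH1

variable {u : ℝ → ℝ}

theorem const_mul (hu : MemH1 u) (k : ℝ) : MemH1 (fun x => k * u x) := by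
  obtain ⟨h1, h2, h3⟩ := memH1_iff.1 hu
  refine memH1_iff.2 ⟨h1.const_mul k, h2.const_mul k, ?_⟩
  rw [show deriv (fun x => k * u x) = fun x => k * deriv u x from
    funext fun x => deriv_const_mul_field k]
  exact h3.const_mul k

/-- u² is locally absolutely continuous, and both it and its derivative 2uu' are integrable, so it
vanishes at infinity and attains its maximum. -/
theorem exists_forall_abs_le (hu : MemH1 u) (h0 : u ≠ 0) : ∃ a, u a ≠ 0 ∧ ∀ x, |u x| ≤ |u a| := by
  obtain ⟨x₀, hx₀⟩ := Function.ne_iff.1 h0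
  have hac := hu.locallyAC.mul hu.locallyAC
  have hi : Integrable fun x => u x * u x := by simpa only [sq] using hu.integrable_sq
  have hd : Integrable (deriv fun x => u x * u x) := by
    refine (hu.integrable_mul_deriv.const_mul 2).congr ?_
    filter_upwards [hu.locallyAC.ae_differentiableAt] with x hx
    refine (Eq.trans (hx.hasDerivAt.mul hx.hasDerivAt).deriv ?_).symm
    ring
  have ht : Tendsto (fun x => u x * u x) (cocompact ℝ) (𝓝 0) := by
    rw [cocompact_eq_atBot_atTop]
    exact (hac.tendsto_atBot_of_integrable hi hd).sup (hac.tendsto_atTop_of_integrable hi hd)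
  obtain ⟨a, ha⟩ := hac.continuous.exists_forall_ge' x₀
    (ht.eventually_le_const (mul_self_pos.2 hx₀))
  refine ⟨a, fun h => ?_, fun x => sq_le_sq.1 ?_⟩
  · have := ha x₀
    rw [h, mul_zero] at this
    exact absurd this (not_le.2 (mul_self_pos.2 hx₀))
  · simpa only [sq] using ha x

end MemH1

namespace IsRiccatiPair

variable {u V p q : ℝ → ℝ} {c d : ℝ}

theorem supNorm_mul_profile (h : IsRiccatiPair V p q c d) (k a : ℝ) :
    supNorm (fun x => k * profile p q a x) = |k| := by
  have := supNorm_eq_of_forall_le (((h.memH1_profile a).const_mul k).1) (a := a) (fun x => ?_)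
  · rw [this, profile_self, mul_one]
  · rw [abs_mul, abs_mul, profile_self]
    refine mul_le_mul_of_nonneg_left ?_ (abs_nonneg k)
    rw [abs_of_pos (profile_pos p q a x), abs_one]
    exact h.profile_le_one a x

theorem profile_mem_K (h : IsRiccatiPair V p q c d) (a : ℝ) : profile p q a ∈ K a :=
  ⟨h.memH1_profile a, profile_self p q a, by simpa using h.supNorm_mul_profile 1 a⟩

theorem energy_mul_profile (h : IsRiccatiPair V p q c d) (k a : ℝ) :
    energy V (fun x => k * profile p q a x) = (p a + q a) * k ^ 2 := by
  have hp := (h.energy_eq_iff (h.memH1_profile a) a).1 (by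
    rw [h.energy_profile, profile_self]; ring)
  have := (h.energy_eq_iff ((h.memH1_profile a).const_mul k) a).2 ⟨?_, ?_⟩
  · rw [this, profile_self, mul_one]
  · filter_upwards [hp.1] with x hx hxa
    rw [deriv_const_mul_field]
    linear_combination k * hx hxa
  · filter_upwards [hp.2] with x hx hxa
    rw [deriv_const_mul_field]
    linear_combination k * hx hxa

theorem rayleigh_mul_profile (h : IsRiccatiPair V p q c d) {k : ℝ} (hk : k ≠ 0) (a : ℝ) :
    rayleigh V (fun x => k * profile p q a x) = p a + q a := by
  rw [rayleigh, h.energy_mul_profile, h.supNorm_mul_profile, sq_abs]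
  exact mul_div_cancel_right₀ _ (pow_ne_zero 2 hk)

theorem isLeast_energy (h : IsRiccatiPair V p q c d) (a : ℝ) :
    IsLeast (energy V '' K a) (p a + q a) := by
  refine ⟨⟨_, h.profile_mem_K a, h.energy_profile a⟩, ?_⟩
  rintro _ ⟨u, hu, rfl⟩
  have := h.le_energy hu.1 a
  rwa [hu.2.1, one_pow, mul_one] at this

theorem F_eq (h : IsRiccatiPair V p q c d) (a : ℝ) : F V a = p a + q a :=
  (h.isLeast_energy a).csInf_eq

theorem eq_profile (h : IsRiccatiPair V p q c d) {a : ℝ} (hu : u ∈ K a)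
    (he : energy V u = F V a) : u = profile p q a := by
  have := h.eq_mul_profile hu.1 (a := a) (by rw [he, h.F_eq, hu.2.1]; ring)
  rw [this, hu.2.1]
  simp

theorem minimizer_eq (h : IsRiccatiPair V p q c d) (a : ℝ) : minimizer V a = profile p q a := by
  have hex : ∃ u ∈ K a, IsMinOn (energy V) (K a) u := by
    refine ⟨_, h.profile_mem_K a, fun u hu => ?_⟩
    rw [Set.mem_ofPred_eq, h.energy_profile]
    exact (h.isLeast_energy a).2 ⟨u, hu, rfl⟩
  rw [minimizer, dif_pos hex]
  obtain ⟨h1, h2⟩ := hex.choose_spec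
  refine h.eq_profile h1 (le_antisymm ?_ ?_)
  · rw [h.F_eq, ← h.energy_profile a]
    exact h2 (h.profile_mem_K a)
  · rw [h.F_eq]
    exact (h.isLeast_energy a).2 ⟨_, h1, rfl⟩

/-- In p' + q' the potential cancels, leaving F' = p² - q², which is C¹ since p and q are. -/
theorem contDiff_F (h : IsRiccatiPair V p q c d) : ContDiff ℝ 2 (F V) := by
  have hF : F V = fun a => p a + q a := funext h.F_eq
  have hdp : deriv p = fun x => p x ^ 2 - V x := funext fun x => (h.hasDerivAt_left x).deriv
  have hdq : deriv q = fun x => V x - q x ^ 2 := funext fun x => (h.hasDerivAt_right x).deriv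
  have hp : ContDiff ℝ 1 p := contDiff_one_iff_deriv.2
    ⟨fun x => (h.hasDerivAt_left x).differentiableAt, by
      rw [hdp]; exact (h.continuous_left.pow 2).sub h.cont⟩
  have hq : ContDiff ℝ 1 q := contDiff_one_iff_deriv.2
    ⟨fun x => (h.hasDerivAt_right x).differentiableAt, by
      rw [hdq]; exact h.cont.sub (h.continuous_right.pow 2)⟩
  have hd (x : ℝ) : HasDerivAt (F V) (p x ^ 2 - q x ^ 2) x := by
    rw [hF]
    exact ((h.hasDerivAt_left x).fun_add (h.hasDerivAt_right x)).congr_deriv (by ring)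
  rw [show (2 : WithTop ℕ∞) = 1 + 1 by norm_num, contDiff_succ_iff_deriv]
  refine ⟨fun x => (hd x).differentiableAt, by simp, ?_⟩
  rw [show deriv (F V) = fun x => p x ^ 2 - q x ^ 2 from funext fun x => (hd x).deriv]
  exact (hp.pow 2).sub (hq.pow 2)

/-- Take a to be a maximum point of |u| and apply `le_energy` there; the equality case is
`eq_mul_profile`. -/
theorem exists_F_le_rayleigh (h : IsRiccatiPair V p q c d) (hu : MemH1 u) (h0 : u ≠ 0) :
    ∃ a, u a ≠ 0 ∧ F V a ≤ rayleigh V u ∧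
      (rayleigh V u ≤ F V a → u = fun x => u a * profile p q a x) := by
  obtain ⟨a, ha, hmax⟩ := hu.exists_forall_abs_le h0
  have hpos : 0 < u a ^ 2 := by positivity
  have hR : rayleigh V u = energy V u / u a ^ 2 := by
    rw [rayleigh, supNorm_eq_of_forall_le hu.1 hmax, sq_abs]
  refine ⟨a, ha, ?_, fun hle => ?_⟩
  · rw [hR, le_div_iff₀ hpos, h.F_eq]
    exact h.le_energy hu a
  · rw [hR, div_le_iff₀ hpos, h.F_eq] at hle
    exact h.eq_mul_profile hu (le_antisymm hle (h.le_energy hu a))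

theorem isGLB_m (h : IsRiccatiPair V p q c d) : IsGLB (Set.range (F V)) (m V) := by
  have hne : (rayleigh V '' {u | MemH1 u ∧ u ≠ 0}).Nonempty :=
    ⟨_, _, ⟨(h.memH1_profile 0).const_mul 1, mul_profile_ne_zero one_ne_zero 0⟩, rfl⟩
  have hF (a : ℝ) : 0 ≤ F V a := by
    rw [h.F_eq]
    linarith [h.pos, (h.bound_left a).1, (h.bound_right a).1]
  have hbdd : BddBelow (rayleigh V '' {u | MemH1 u ∧ u ≠ 0}) := by
    refine ⟨0, ?_⟩
    rintro _ ⟨u, ⟨hu, h0⟩, rfl⟩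
    obtain ⟨a, -, ha, -⟩ := h.exists_F_le_rayleigh hu h0
    exact (hF a).trans ha
  constructor
  · rintro _ ⟨a, rfl⟩
    refine csInf_le hbdd ⟨fun x => 1 * profile p q a x,
      ⟨(h.memH1_profile a).const_mul 1, mul_profile_ne_zero one_ne_zero a⟩, ?_⟩
    rw [h.rayleigh_mul_profile one_ne_zero, h.F_eq]
  · intro b hb
    refine le_csInf hne ?_
    rintro _ ⟨u, ⟨hu, h0⟩, rfl⟩
    obtain ⟨a, -, ha, -⟩ := h.exists_F_le_rayleigh hu h0
    exact (hb ⟨a, rfl⟩).trans ha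

theorem M_eq (h : IsRiccatiPair V p q c d) :
    M V = {u | ∃ c a : ℝ, c ≠ 0 ∧ F V a = m V ∧ u = fun x => c * minimizer V a x} := by
  ext u
  constructor
  · rintro ⟨hu, hm, h0⟩
    obtain ⟨a, ha, hle, heq⟩ := h.exists_F_le_rayleigh hu h0
    have hma : m V ≤ F V a := h.isGLB_m.1 ⟨a, rfl⟩
    refine ⟨u a, a, ha, le_antisymm (hm ▸ hle) hma, ?_⟩
    rw [h.minimizer_eq]
    exact heq (hm ▸ hma)
  · rintro ⟨k, a, hk, ha, rfl⟩
    rw [h.minimizer_eq]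
    exact ⟨(h.memH1_profile a).const_mul k, by rw [h.rayleigh_mul_profile hk, ← ha, h.F_eq],
      mul_profile_ne_zero hk a⟩

end IsRiccatiPair

/-! ### Attained infimum versus infimum at infinity. -/

/-- A negative second derivative would make a also a local maximum, so f would be constant near a
and the second derivative zero. -/
theorem deriv_deriv_nonneg_of_isLocalMin {f : ℝ → ℝ} {a : ℝ} (hf : Continuous f)
    (h : IsLocalMin f a) : 0 ≤ deriv (deriv f) a := by
  by_contra! hneg
  have hmax := isLocalMax_of_deriv_deriv_neg hneg h.deriv_eq_zero hf.continuousAt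
  have hconst : f =ᶠ[𝓝 a] fun _ => f a := by
    filter_upwards [h, hmax] with x h1 h2 using le_antisymm h2 h1
  have : deriv (deriv f) a = 0 := by
    rw [hconst.deriv.deriv_eq]; simp
  exact hneg.ne this

/-- If the liminf exceeded m, some level r > m would be exceeded outside a compact set while f dips
below r somewhere; f would then attain its infimum. -/
theorem liminf_le_of_isGLB_of_notMem {f : ℝ → ℝ} (hf : Continuous f) {m : ℝ}
    (hm : IsGLB (Set.range f) m) (hne : ∀ a, f a ≠ m) :
    liminf (fun a : ℝ => (f a : EReal)) (comap (fun a : ℝ => |a|) atTop) ≤ m := by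
  by_contra! hlt
  obtain ⟨r, hr1, hr2⟩ := EReal.lt_iff_exists_real_btwn.1 hlt
  have hev := eventually_lt_of_lt_liminf hr2
  rw [comap_abs_atTop, ← cocompact_eq_atBot_atTop] at hev
  have hr : m < r := by exact_mod_cast hr1
  obtain ⟨a, ha⟩ : ∃ a, f a < r := by
    by_contra! hge
    exact hr.not_ge (hm.2 (by rintro _ ⟨a, rfl⟩; exact hge a))
  obtain ⟨b, hb⟩ := hf.exists_forall_le' a (by
    filter_upwards [hev] with x hx
    exact ha.le.trans (by exact_mod_cast hx.le))
  have hbm : f b ≤ m := hm.2 (by rintro _ ⟨x, rfl⟩; exact hb x)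
  exact hne b (le_antisymm hbm (hm.1 ⟨b, rfl⟩))

end SobolevBest

open SobolevBest in
theorem mainTheorem5 (V : ℝ → ℝ) (v₀ v₁ : ℝ) (hV : Continuous V) (hv₀ : 0 < v₀)
    (hbdd : ∀ᵐ x, v₀ ≤ V x ∧ V x ≤ v₁) :
    (∀ a : ℝ, SobolevBest.minimizer V a ∈ SobolevBest.K a ∧
      SobolevBest.energy V (SobolevBest.minimizer V a) = SobolevBest.F V a ∧
      ∀ w ∈ SobolevBest.K a, SobolevBest.energy V w = SobolevBest.F V a →
        w = SobolevBest.minimizer V a) ∧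
    ContDiff ℝ 2 (SobolevBest.F V) ∧
    (SobolevBest.m V : EReal) =
      min (SobolevBest.liminfF V) (⨅ a ∈ SobolevBest.N V, (SobolevBest.F V a : EReal)) ∧
    SobolevBest.M V =
      {u : ℝ → ℝ | ∃ c a : ℝ, c ≠ 0 ∧ SobolevBest.F V a = SobolevBest.m V ∧
        u = fun x => c * SobolevBest.minimizer V a x} ∧
    (SobolevBest.M V = ∅ ↔
      ∀ b ∈ SobolevBest.N V, SobolevBest.liminfF V < (SobolevBest.F V b : EReal)) := by
  -- A set of full measure is dense, so continuity extends the a.e. bounds to every point.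
  have hb (x : ℝ) : v₀ ≤ V x ∧ V x ≤ v₁ := by
    have hd := Measure.dense_of_ae hbdd
    have hc : IsClosed {x | v₀ ≤ V x ∧ V x ≤ v₁} :=
      (isClosed_le continuous_const hV).inter (isClosed_le hV continuous_const)
    have : x ∈ closure {x | v₀ ≤ V x ∧ V x ≤ v₁} := hd x
    rwa [hc.closure_eq] at this
  have h01 : v₀ ≤ v₁ := (hb 0).1.trans (hb 0).2
  obtain ⟨p, q, h⟩ := exists_isRiccatiPair hV (Real.sqrt_pos.2 hv₀) (Real.sqrt_le_sqrt h01)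
    (fun x => by rw [Real.sq_sqrt hv₀.le, Real.sq_sqrt (hv₀.le.trans h01)]; exact hb x)
  have hF := h.contDiff_F
  have hglb := h.isGLB_m
  have hm (a : ℝ) : m V ≤ F V a := hglb.1 ⟨a, rfl⟩
  have hN (a : ℝ) (ha : F V a = m V) : a ∈ N V := by
    have hmin : IsLocalMin (F V) a := Eventually.of_forall fun x => ha ▸ hm x
    exact ⟨hmin.deriv_eq_zero, deriv_deriv_nonneg_of_isLocalMin hF.continuous hmin⟩
  have hmL : (m V : EReal) ≤ liminfF V :=
    le_liminf_of_le (h := Eventually.of_forall fun a => EReal.coe_le_coe_iff.2 (hm a))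
  have hL (hne : ∀ a, F V a ≠ m V) : liminfF V ≤ m V :=
    liminf_le_of_isGLB_of_notMem hF.continuous hglb hne
  have hM : M V = ∅ ↔ ∀ a, F V a ≠ m V := by
    rw [h.M_eq, Set.eq_empty_iff_forall_notMem]
    exact ⟨fun he a ha => he _ ⟨1, a, one_ne_zero, ha, rfl⟩,
      fun he u ⟨_, a, _, ha, _⟩ => he a ha⟩
  refine ⟨fun a => ?_, hF, le_antisymm ?_ ?_, h.M_eq, hM.trans ⟨fun hne b _ => ?_, fun hlt a ha => ?_⟩⟩
  · rw [h.minimizer_eq]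
    exact ⟨h.profile_mem_K a, by rw [h.energy_profile, h.F_eq], fun w hw he => h.eq_profile hw he⟩
  · exact le_min hmL (le_iInf₂ fun a _ => EReal.coe_le_coe_iff.2 (hm a))
  -- If the infimum is not attained, the liminf realizes it; otherwise a minimum point, which lies
  -- in `N V`, does.
  · by_cases hne : ∀ a, F V a ≠ m V
    · exact (min_le_left _ _).trans (hL hne)
    · push Not at hne
      obtain ⟨a, ha⟩ := hne
      exact (min_le_right _ _).trans ((iInf₂_le a (hN a ha)).trans_eq (by rw [ha]))
  · exact (hL hne).trans_lt (EReal.coe_lt_coe_iff.2 (lt_of_le_of_ne (hm b) (hne b).symm))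
  · have := hlt a (hN a ha)
    rw [ha] at this
    exact this.not_ge hmL
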